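/- A stochastic cellular automaton (CA) is a tuple $A=(Q,R,V,V',f)$ with finite nonempty sets $Q$ (states) and $R$ (random symbols), finite sets $V,V'\subset\mathbb Z$ and a local function $f:Q^{V}\times R^{V'}\to Q$. Its explicit global function is $F:Q^{\mathbb Z}\times R^{\mathbb Z}\to Q^{\mathbb Z}$, $F(c,s)_z=f\big((c_{z+v})_{v\in V},(s_{z+v'})_{v'\in V'}\big)$, and its stochastic global function $S_F$ maps $c\in Q^{\mathbb Z}$ to the law of $F(c,s)$, where $s$ is uniformly distributed on $R^{\mathbb Z}$. $A$ is a plain probabilistic CA (PCA) if $V'=\{0\}$. $\mathrm{PF}(A)$ denotes the set of prime factors of $|R|$. *Rescaling.* For $m,t\ge1$ and $k\in\mathbb Z$, $A^{\langle m,t,k\rangle}$ is the stochastic CA with states $Q^m$, random symbols $(R^m)^t$ and explicit global function $(c,s)\mapsto b_m\circ\sigma_k\circ F^t\big(b_m^{-1}(c),b_m^{-1}(s^1),\dots,b_m^{-1}(s^t)\big)$, where $F^0(c)=c$, $F^{j+1}(c,s^1,\dots,s^{j+1})=F(F^j(c,s^1,\dots,s^j),s^{j+1})$, $\sigma_k(c)_z=c_{z+k}$,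 $b_m(c)_z=(c_{mz},\dots,c_{mz+m-1})$, and $s^1,\dots,s^t$ are the $t$ components of $s$. *Trimming.* If $i:Q'\to Q$ is injective and $F(i(Q')^{\mathbb Z}\times R^{\mathbb Z})\subseteq i(Q')^{\mathbb Z}$, the $i$-restriction of $A$ is the stochastic CA with states $Q'$ and random symbols $R$ obtained by transporting $F$ along the cell-by-cell extension of $i$. If $\pi:Q\to Q'$ is surjective with cell-by-cell extension $\Pi$, and $\Pi(F(c,s))=\Pi(F(c',s))$ whenever $\Pi(c)=\Pi(c')$, the $\pi$-projection of $A$ is the stochastic CA with states $Q'$ and random symbols $R$ and explicit global function $(\Pi(c),s)\mapsto\Pi(F(c,s))$. *Simulation.* $A_1\preceq_i A_2$ (resp. $A_1\preceq_m A_2$) if there are $m_1,m_2,t_1,t_2\ge1$ and $k_1,k_2\in\mathbb Z$ such that $A_1^{\langle m_1,t_1,k_1\rangle}$ has the same stochastic global function as some restriction (resp. some projection of a restriction) of $A_2^{\langle m_2,t_2,k_2\rangle}$. **Theorem.** Let $P$ be a finite set of prime numbers. 1. There is a PCA $U_P$ with $\mathrm{PF}(U_P)=P$ such that every stochastic CA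 $A$ with $\mathrm{PF}(A)\subseteq P$ satisfies $A\preceq_i U_P$ and $A\preceq_m U_P$. 2. (Optimality.) For every prime $p\notin P$ there is a stochastic CA $A$ with $\mathrm{PF}(A)=\{p\}$ such that no stochastic CA $U$ with $\mathrm{PF}(U)\subseteq P$ satisfies $A\preceq_i U$ or $A\preceq_m U$. In particular, $U_P$ does not simulate all stochastic CA whose prime factors lie in any set of primes not contained in $P$. -/

import Mathlib

open MeasureTheory
open scoped Pointwise

noncomputable section

/-- A stochastic cellular automaton on the line: finite nonempty sets `Q` of states and `R` of
random symbols, finite neighborhoods `V`, `V'` and a local transition function. -/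
structure StochCA where
  Q : Type
  R : Type
  [finiteQ : Finite Q]
  [nonemptyQ : Nonempty Q]
  [finiteR : Finite R]
  [nonemptyR : Nonempty R]
  V : Finset ℤ
  V' : Finset ℤ
  f : (V → Q) → (V' → R) → Q

namespace StochCA

attribute [instance] finiteQ nonemptyQ finiteR nonemptyR

/-- States and random symbols carry the discrete σ-algebra; configurations carry the product one,
which is the Borel σ-algebra of the Cantor topology. -/
instance instMeasurableSpaceQ (A : StochCA) : MeasurableSpace A.Q := ⊤

instance instMeasurableSpaceR (A : StochCA) : MeasurableSpace A.R := ⊤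

instance instDiscreteQ (A : StochCA) : DiscreteMeasurableSpace A.Q := ⟨fun _ => trivial⟩

instance instDiscreteR (A : StochCA) : DiscreteMeasurableSpace A.R := ⟨fun _ => trivial⟩

/-- Plain probabilistic cellular automaton: each cell uses its own random symbol only. -/
def IsPCA (A : StochCA) : Prop := A.V' = {0}

/-- The set of prime factors of the size of the random alphabet. -/
def PF (A : StochCA) : Finset ℕ := (Nat.card A.R).primeFactors

/-- The explicit global function. -/
def global (A : StochCA) (c : ℤ → A.Q) (s : ℤ → A.R) : ℤ → A.Q :=
  fun z => A.f (fun v => c (z + v)) (fun v => s (z + v))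

/-- The iterates of the explicit global function, fed with `t` random configurations. -/
def iter (A : StochCA) : (t : ℕ) → (ℤ → A.Q) → (Fin t → ℤ → A.R) → ℤ → A.Q
  | 0, c, _ => c
  | t + 1, c, s => A.global (A.iter t c (fun j => s j.castSucc)) (s (Fin.last t))

/-- The uniform probability measure on the random configurations of `A`. -/
def randomSource (A : StochCA) : Measure (ℤ → A.R) :=
  Measure.infinitePi fun _ : ℤ => ProbabilityTheory.uniformOn (Set.univ : Set A.R)

/-- The stochastic global function: the law of the image of `c` when the random configuration is
uniform. -/
def stochGlobal (A : StochCA) (c : ℤ → A.Q) : Measure (ℤ → A.Q) :=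
  A.randomSource.map (A.global c)

theorem measurable_global (A : StochCA) (c : ℤ → A.Q) : Measurable (A.global c) := by
  refine measurable_pi_lambda _ fun z => ?_
  have h : Measurable (A.f fun v => c (z + v)) := measurable_of_finite _
  exact h.comp (measurable_pi_lambda _ fun v => measurable_pi_apply _)

/-- The value on the cylinder of the word `u` at position `z`. -/
theorem stochGlobal_cylinder (A : StochCA) (c : ℤ → A.Q) (u : List A.Q) (z : ℤ) :
    A.stochGlobal c {d | ∀ x : Fin u.length, d (z + (x : ℕ)) = u[x]} =
      A.randomSource {s | ∀ x : Fin u.length, A.global c s (z + (x : ℕ)) = u[x]} := by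
  rw [stochGlobal, Measure.map_apply (A.measurable_global c)]
  · rfl
  · have h : ∀ x : Fin u.length, MeasurableSet {d : ℤ → A.Q | d (z + (x : ℕ)) = u[x]} :=
      fun x => (measurable_pi_apply (X := fun _ : ℤ => A.Q) (z + (x : ℕ)))
        (MeasurableSet.of_discrete (s := ({u[x]} : Set A.Q)))
    convert MeasurableSet.iInter h using 1
    ext d
    simp

/-! ### Trimming operations -/

/-- `i` is injective and `i(Q')^ℤ` is stable under the explicit global function. -/
def CanRestrict (A : StochCA) {Q' : Type} (i : Q' → A.Q) : Prop :=
  Function.Injective i ∧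
    ∀ (c : ℤ → A.Q) (s : ℤ → A.R), (∀ z, c z ∈ Set.range i) → ∀ z, A.global c s z ∈ Set.range i

/-- The `i`-restriction (meaningful when `A.CanRestrict i`, see `global_restrict`). -/
def restrict (A : StochCA) {Q' : Type} [Finite Q'] [Nonempty Q'] (i : Q' → A.Q) : StochCA where
  Q := Q'
  R := A.R
  V := A.V
  V' := A.V'
  f := fun x s => Function.invFun i (A.f (fun v => i (x v)) s)

theorem global_restrict (A : StochCA) {Q' : Type} [Finite Q'] [Nonempty Q'] (i : Q' → A.Q)
    (h : A.CanRestrict i) (c : ℤ → Q') (s : ℤ → A.R) :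
    (fun z => i ((A.restrict i).global c s z)) = A.global (fun z => i (c z)) s := by
  funext z
  exact Function.invFun_eq (h.2 (fun z => i (c z)) s (fun z => ⟨c z, rfl⟩) z)

/-- `π` is surjective and compatible with the explicit global function. -/
def CanProject (A : StochCA) {Q' : Type} (π : A.Q → Q') : Prop :=
  Function.Surjective π ∧
    ∀ (s : ℤ → A.R) (c c' : ℤ → A.Q), (∀ z, π (c z) = π (c' z)) →
      ∀ z, π (A.global c s z) = π (A.global c' s z)

/-- The `π`-projection (meaningful when `A.CanProject π`, see `global_project`). -/
def project (A : StochCA) {Q' : Type} [Finite Q'] [Nonempty Q'] (π : A.Q → Q') : StochCA where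
  Q := Q'
  R := A.R
  V := A.V
  V' := A.V'
  f := fun x s => π (A.f (fun v => Function.invFun π (x v)) s)

theorem global_project (A : StochCA) {Q' : Type} [Finite Q'] [Nonempty Q'] (π : A.Q → Q')
    (h : A.CanProject π) (c : ℤ → A.Q) (s : ℤ → A.R) :
    (A.project π).global (fun z => π (c z)) s = fun z => π (A.global c s z) := by
  funext z
  exact h.2 s (fun z => Function.invFun π (π (c z))) c
    (fun z => Function.invFun_eq ⟨c z, rfl⟩) z

/-- `A₁` is a stochastic subautomaton of `A₂`. -/
def StochSub (A₁ A₂ : StochCA) : Prop :=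
  ∃ i : A₁.Q → A₂.Q, A₂.CanRestrict i ∧ A₁.stochGlobal = (A₂.restrict i).stochGlobal

/-- `A₁` has the stochastic global function of a projection of a restriction of `A₂`. -/
def StochMix (A₁ A₂ : StochCA) : Prop :=
  ∃ (Q' : Type) (_ : Finite Q') (_ : Nonempty Q') (i : Q' → A₂.Q) (π : Q' → A₁.Q),
    A₂.CanRestrict i ∧ (A₂.restrict i).CanProject π ∧
      A₁.stochGlobal = ((A₂.restrict i).project (Q' := A₁.Q) π).stochGlobal

/-! ### Rescaling -/

/-- Translation of configurations. -/
def shift {S : Type} (k : ℤ) (c : ℤ → S) : ℤ → S := fun z => c (z + k)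

/-- The packing map: the cells `m z, …, m z + m - 1` form the block `z`. -/
def pack {S : Type} (m : ℕ) (c : ℤ → S) : ℤ → Fin m → S := fun z j => c (m * z + (j : ℕ))

/-- The inverse of the packing map. -/
def unpack {S : Type} (m : ℕ) [NeZero m] (c : ℤ → Fin m → S) : ℤ → S :=
  fun z => c (z / m) ⟨(z % m).toNat, by
    have hm : (0 : ℤ) < m := by exact_mod_cast Nat.pos_of_neZero m
    have h1 := Int.emod_nonneg z hm.ne'
    have h2 := Int.emod_lt_of_pos z hm
    omega⟩

theorem unpack_pack {S : Type} (m : ℕ) [NeZero m] (c : ℤ → S) : unpack m (pack m c) = c := by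
  funext z
  have hm : (0 : ℤ) < m := by exact_mod_cast Nat.pos_of_neZero m
  have h1 := Int.emod_nonneg z hm.ne'
  simp only [unpack, pack, Int.toNat_of_nonneg h1]
  rw [Int.mul_ediv_add_emod]

theorem pack_unpack {S : Type} (m : ℕ) [NeZero m] (c : ℤ → Fin m → S) :
    pack m (unpack m c) = c := by
  funext z j
  have hm : (0 : ℤ) < m := by exact_mod_cast Nat.pos_of_neZero m
  have hj : ((j : ℕ) : ℤ) < m := by exact_mod_cast j.2
  have h1 : ((m : ℤ) * z + (j : ℕ)) / m = z := by
    rw [Int.mul_add_ediv_left _ _ hm.ne', Int.ediv_eq_zero_of_lt (by positivity) hj, add_zero]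
  have h2 : ((m : ℤ) * z + (j : ℕ)) % m = (j : ℕ) := by
    rw [Int.mul_add_emod_self_left, Int.emod_eq_of_lt (by positivity) hj]
  simp only [pack, unpack, h1, h2, Int.toNat_natCast]

/-- The explicit global function of the rescaling with parameters `(m, t, k)`: unpack, iterate `t`
times, translate by `k`, pack. -/
def rescaleGlobal (A : StochCA) (m t : ℕ) [NeZero m] (k : ℤ) (c : ℤ → Fin m → A.Q)
    (s : ℤ → Fin t → Fin m → A.R) : ℤ → Fin m → A.Q :=
  pack m (shift k (A.iter t (unpack m c) (fun j => unpack m (fun z => s z j))))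

/-- Relative positions of the states on which `t` steps depend. -/
def iterV (A : StochCA) : ℕ → Finset ℤ
  | 0 => {0}
  | t + 1 => A.V + A.iterV t

/-- Relative positions of the random symbols on which `t` steps depend. -/
def iterV' (A : StochCA) : ℕ → Finset ℤ
  | 0 => ∅
  | t + 1 => A.V' ∪ (A.V + A.iterV' t)

/-- Relative positions of the blocks met by the cells `j + k + v`, `0 ≤ j < m`, `v ∈ N`. -/
def blockNbhd (m : ℕ) (k : ℤ) (N : Finset ℤ) : Finset ℤ :=
  (Finset.range m ×ˢ N).image fun p => ((p.1 : ℤ) + k + p.2) / m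

/-- Extend a pattern to a configuration, arbitrarily outside of its support. -/
def extend {S : Type} [Nonempty S] {N : Finset ℤ} (x : N → S) : ℤ → S :=
  fun z => if h : z ∈ N then x ⟨z, h⟩ else Classical.arbitrary S

/-- The rescaling of `A` with parameters `(m, t, k)`; its explicit global function is
`rescaleGlobal`, see `global_rescale`. -/
def rescale (A : StochCA) (m t : ℕ) [NeZero m] (k : ℤ) : StochCA where
  Q := Fin m → A.Q
  R := Fin t → Fin m → A.R
  V := blockNbhd m k (A.iterV t)
  V' := blockNbhd m k (A.iterV' t)
  f := fun x s => A.rescaleGlobal m t k (extend x) (extend s) 0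

theorem iter_congr (A : StochCA) (t : ℕ) (c c' : ℤ → A.Q) (s s' : Fin t → ℤ → A.R) (z z' : ℤ)
    (hc : ∀ v ∈ A.iterV t, c (z + v) = c' (z' + v))
    (hs : ∀ v ∈ A.iterV' t, ∀ j, s j (z + v) = s' j (z' + v)) :
    A.iter t c s z = A.iter t c' s' z' := by
  induction t generalizing z z' with
  | zero => simpa [iter, iterV] using hc
  | succ t ih =>
    simp only [iter, global]
    congr 1
    · funext v
      refine ih _ _ _ _ (fun w hw => ?_) (fun w hw j => ?_)
      · simpa only [add_assoc] using hc _ (Finset.add_mem_add v.2 hw)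
      · simpa only [add_assoc] using
          hs _ (Finset.mem_union_right _ (Finset.add_mem_add v.2 hw)) j.castSucc
    · funext v
      exact hs _ (Finset.mem_union_left _ v.2) _

theorem global_rescale (A : StochCA) (m t : ℕ) [NeZero m] (k : ℤ) (c : ℤ → Fin m → A.Q)
    (s : ℤ → Fin t → Fin m → A.R) :
    (A.rescale m t k).global c s = A.rescaleGlobal m t k c s := by
  have hm : (m : ℤ) ≠ 0 := by exact_mod_cast NeZero.ne m
  funext z j
  change A.rescaleGlobal m t k (extend _) (extend _) 0 j = _
  simp only [rescaleGlobal, pack, shift]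
  have hd : ∀ v : ℤ, ((m : ℤ) * z + (j : ℕ) + k + v) / m = z + ((j : ℕ) + k + v) / m := by
    intro v
    rw [add_assoc, add_assoc, Int.mul_add_ediv_left _ _ hm, ← add_assoc]
  have he : ∀ v : ℤ, ((m : ℤ) * z + (j : ℕ) + k + v) % m = ((j : ℕ) + k + v) % m := by
    intro v
    rw [add_assoc, add_assoc, Int.mul_add_emod_self_left, ← add_assoc]
  have hmem : ∀ (N : Finset ℤ) (v : ℤ), v ∈ N → (((j : ℕ) : ℤ) + k + v) / m ∈ blockNbhd m k N :=
    fun N v hv => Finset.mem_image.2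
      ⟨((j : ℕ), v), Finset.mem_product.2 ⟨Finset.mem_range.2 j.2, hv⟩, rfl⟩
  refine A.iter_congr t _ _ _ _ _ _ (fun v hv => ?_) (fun v hv l => ?_)
  · simp only [unpack, mul_zero, zero_add, hd, he, extend]
    rw [dif_pos (hmem _ v hv)]
  · simp only [unpack, mul_zero, zero_add, hd, he, extend]
    rw [dif_pos (hmem _ v hv)]

/-! ### Simulation pre-orders -/

/-- The stochastic injective simulation pre-order: `A₂` simulates `A₁`. -/
def SimInj (A₁ A₂ : StochCA) : Prop :=
  ∃ (m₁ m₂ t₁ t₂ : ℕ+) (k₁ k₂ : ℤ), StochSub (A₁.rescale m₁ t₁ k₁) (A₂.rescale m₂ t₂ k₂)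

/-- The stochastic mixed simulation pre-order: `A₂` simulates `A₁`. -/
def SimMix (A₁ A₂ : StochCA) : Prop :=
  ∃ (m₁ m₂ t₁ t₂ : ℕ+) (k₁ k₂ : ℤ), StochMix (A₁.rescale m₁ t₁ k₁) (A₂.rescale m₂ t₂ k₂)

end StochCA

end

/-
Universality. In the collision automaton heads stay, letters move left at speed one and
instructions at speed two, so when the word of a block crosses the heads of the block before it,
each meeting of a head with a letter can be given an instruction of its own. The heads thus run
through a program, with a random symbol read only where they stand. Group and translate the cells
of the given automaton so that a cell depends on itself and its right neighbor, and give a block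
one head per pair of argument words of the local rule. In three rounds, every block receives the
words of three neighbors in turn; an entry head compares the first two with its own pair and, if
both agree, writes the value of the rule over the third. The random symbols of the given automaton
are read through a balanced map off those picked up by a long word, which exists because the size
of its random alphabet divides a power of that of the universal one.

Optimality. The probability of an event on one cell is a fraction whose denominator is a power of
the size of the random alphabet, and rescaling, restriction and projection bring in no new prime
factor, whereas a cell of a uniform independent noise on `p` values takes each value with
probability `1 / p`.
-/

/-- A map is balanced if it is the first projection of a product, up to a bijection. Reading random
symbols through a balanced map sends uniform symbols to uniform symbols. -/
def IsBalanced {X Y : Type*} (g : X → Y) : Prop :=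
  ∃ (K : Type) (e : X ≃ Y × K), ∀ x, (e x).1 = g x

namespace IsBalanced

theorem of_equiv {X Y : Type*} (e : X ≃ Y) : IsBalanced e :=
  ⟨Unit, e.trans (Equiv.prodPUnit Y).symm, fun _ => rfl⟩

theorem comp {X Y Z : Type*} {g : Y → Z} {h : X → Y} (hg : IsBalanced g) (hh : IsBalanced h) :
    IsBalanced (g ∘ h) := by
  obtain ⟨K, e, he⟩ := hg
  obtain ⟨K', e', he'⟩ := hh
  exact ⟨K × K', e'.trans ((e.prodCongr (Equiv.refl K')).trans (Equiv.prodAssoc _ _ _)),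
    fun x => (he _).trans (congrArg g (he' x))⟩

theorem precomp {ι κ R : Type} {j : ι → κ} (hj : Function.Injective j) :
    IsBalanced fun s : κ → R => s ∘ j := by
  classical
  exact ⟨{k // k ∉ Set.range j} → R,
    (Equiv.piEquivPiSubtypeProd (fun k => k ∈ Set.range j) fun _ => R).trans
      (((Equiv.ofInjective j hj).symm.arrowCongr (Equiv.refl R)).prodCongr (Equiv.refl _)),
    fun _ => rfl⟩

theorem eval {κ R : Type} (k : κ) : IsBalanced fun s : κ → R => s k :=
  (of_equiv (Equiv.funUnique Unit R)).comp (precomp (Function.injective_of_subsingleton fun _ => k))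

theorem exists_of_dvd {X Y : Type} [Finite X] [Finite Y]
    (h : Nat.card Y ∣ Nat.card X) : ∃ g : X → Y, IsBalanced g := by
  obtain ⟨k, hk⟩ := h
  obtain ⟨e⟩ : Nonempty (X ≃ Y × Fin k) := by rw [← Finite.card_eq]; simp [hk]
  exact ⟨fun x => (e x).1, Fin k, e, fun _ => rfl⟩

theorem map_uniformOn {X Y : Type*} [Finite X] [Finite Y] [Nonempty X] [MeasurableSpace X]
    [DiscreteMeasurableSpace X] [MeasurableSpace Y] [DiscreteMeasurableSpace Y] {g : X → Y}
    (hg : IsBalanced g) :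
    (ProbabilityTheory.uniformOn (Set.univ : Set X)).map g =
      ProbabilityTheory.uniformOn (Set.univ : Set Y) := by
  classical
  obtain ⟨K, e, he⟩ := hg
  obtain ⟨x₀⟩ := ‹Nonempty X›
  have : Nonempty Y := ⟨(e x₀).1⟩
  have : Nonempty K := ⟨(e x₀).2⟩
  have : Finite (Y × K) := Finite.of_equiv X e
  have : Finite K := Finite.of_surjective (Prod.snd : Y × K → K) Prod.snd_surjective
  cases nonempty_fintype X
  cases nonempty_fintype Y
  cases nonempty_fintype K
  have hfiber (y : Y) : g ⁻¹' {y} = e ⁻¹' ({y} ×ˢ Set.univ) := by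
    ext x
    simp [he]
  refine Measure.ext_of_singleton fun y => ?_
  rw [Measure.map_apply (measurable_of_finite g) (measurableSet_singleton y), hfiber,
    ProbabilityTheory.uniformOn_univ, ProbabilityTheory.uniformOn_univ,
    Measure.count_apply .of_discrete, Measure.count_singleton,
    Set.encard_preimage_of_bijective e.bijective, Fintype.card_congr e, Fintype.card_prod]
  simpa [Set.encard_prod] using
    ENNReal.mul_div_mul_right 1 (Fintype.card Y) (c := Fintype.card K) (by simp) (by simp)

end IsBalanced

theorem infinitePi_map_comp {ι κ X : Type*} [MeasurableSpace X] (μ : Measure X)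
    [IsProbabilityMeasure μ] {j : ι → κ} (hj : Function.Injective j) :
    (Measure.infinitePi fun _ : κ => μ).map (fun x => x ∘ j) =
      Measure.infinitePi fun _ : ι => μ := by
  classical
  refine Measure.eq_infinitePi _ fun S t ht => ?_
  have hpre : (fun x : κ → X => x ∘ j) ⁻¹' (S : Set ι).pi t =
      ((S.map ⟨j, hj⟩ : Finset κ) : Set κ).pi (Function.extend j t fun _ => Set.univ) := by
    ext x
    simp [hj.extend_apply]
  have hextend (k : κ) : MeasurableSet (Function.extend j t (fun _ => Set.univ) k) := by
    by_cases hk : ∃ i, j i = k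
    · obtain ⟨i, rfl⟩ := hk
      rw [hj.extend_apply]
      exact ht i
    · rw [Function.extend_apply' _ _ _ hk]
      exact .univ
  rw [Measure.map_apply (by fun_prop) (.pi S.countable_toSet fun i _ => ht i), hpre,
    Measure.infinitePi_pi _ fun k _ => hextend k, Finset.prod_map]
  simp [hj.extend_apply]

theorem dvd_pow_of_mul_inv_pow_eq_inv {k r n p : ℕ} (hr : r ≠ 0) (hp : p ≠ 0)
    (h : (k : ENNReal) * (r : ENNReal)⁻¹ ^ n = (p : ENNReal)⁻¹) : p ∣ r ^ n := by
  rw [← ENNReal.inv_pow, ← div_eq_mul_inv, ← one_div,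
    ENNReal.div_eq_div_iff (by simpa) (by simp) (by simp [hr]) (by simp), mul_one] at h
  exact ⟨k, by exact_mod_cast h.symm⟩

theorem exists_enumeration (X : Type*) [Finite X] [Nonempty X] :
    ∃ (M : ℕ) (table : ℕ → X), ∀ x, ∃ i < M, table i = x := by
  obtain ⟨M, ⟨e⟩⟩ := Finite.exists_equiv_fin X
  exact ⟨M, Function.invFun fun x => (e x : ℕ), fun x => ⟨e x, (e x).2,
    Function.leftInverse_invFun (Fin.val_injective.comp e.injective) x⟩⟩

namespace StochCA

theorem map_comp_randomSource (A : StochCA) {ι : Type} [Finite ι] {j : ι → ℤ}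
    (hj : Function.Injective j) :
    A.randomSource.map (fun s => s ∘ j) = ProbabilityTheory.uniformOn Set.univ := by
  cases nonempty_fintype ι
  rw [randomSource, infinitePi_map_comp _ hj, Measure.infinitePi_eq_pi,
    ← ProbabilityTheory.uniformOn_pi, Set.pi_univ]

theorem map_randomSource {A B : StochCA} {g : A.R → B.R} (hg : IsBalanced g) (δ : ℤ) :
    A.randomSource.map (fun s z => g (s (z + δ))) = B.randomSource := by
  have hcomp : (fun (s : ℤ → A.R) (z : ℤ) => g (s (z + δ))) =
      (fun s z => g (s z)) ∘ fun s => s ∘ (· + δ) := rfl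
  have hmeas := measurable_of_finite g
  rw [hcomp, ← Measure.map_map (by fun_prop) (by fun_prop), randomSource,
    infinitePi_map_comp _ (add_left_injective δ), Measure.infinitePi_map_pi _ fun _ => hmeas]
  simp only [hg.map_uniformOn, randomSource]

theorem stochGlobal_apply_eval (A : StochCA) (c : ℤ → A.Q) (z : ℤ) (E : Set A.Q) :
    A.stochGlobal c {d | d z ∈ E} = A.randomSource {s | A.global c s z ∈ E} :=
  Measure.map_apply (A.measurable_global c)
    (measurable_pi_apply (X := fun _ : ℤ => A.Q) z (.of_discrete (s := E)))

theorem exists_stochGlobal_eq (A : StochCA) (c : ℤ → A.Q) (z : ℤ) (E : Set A.Q) :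
    ∃ k n : ℕ, A.stochGlobal c {d | d z ∈ E} = k * (Nat.card A.R : ENNReal)⁻¹ ^ n := by
  classical
  cases nonempty_fintype A.R
  let j (v : A.V') : ℤ := z + v
  have hj : Function.Injective j := (add_right_injective z).comp Subtype.val_injective
  let T : Set (A.V' → A.R) := {x | A.f (fun v => c (z + v)) x ∈ E}
  refine ⟨T.ncard, A.V'.card, ?_⟩
  rw [stochGlobal_apply_eval]
  change A.randomSource ((fun s => s ∘ j) ⁻¹' T) = _
  rw [← Measure.map_apply (by fun_prop) .of_discrete, A.map_comp_randomSource hj,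
    ProbabilityTheory.uniformOn_univ, Measure.count_apply .of_discrete, ← T.toFinite.cast_ncard_eq,
    div_eq_mul_inv, ← ENNReal.inv_pow, Fintype.card_fun, Fintype.card_coe,
    Nat.card_eq_fintype_card, ENat.toENNReal_coe, Nat.cast_pow]

theorem randomSource_apply_balanced_eq (A : StochCA) {Y : Type} [Finite Y] {g : A.R → Y}
    (hg : IsBalanced g) (z : ℤ) (y : Y) :
    A.randomSource {s | g (s z) = y} = (Nat.card Y : ENNReal)⁻¹ := by
  cases nonempty_fintype Y
  let _ : MeasurableSpace Y := ⊤
  have : DiscreteMeasurableSpace Y := ⟨fun _ => trivial⟩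
  change A.randomSource ((fun s => s z) ⁻¹' (g ⁻¹' {y})) = _
  rw [← Measure.map_apply (measurable_pi_apply _) .of_discrete, randomSource,
    Measure.infinitePi_map_eval, ← Measure.map_apply (measurable_of_finite g) .of_discrete,
    hg.map_uniformOn, ProbabilityTheory.uniformOn_univ, Measure.count_singleton, one_div,
    Nat.card_eq_fintype_card]

theorem stochSub_of_global_eq {A B : StochCA} (i : A.Q → B.Q) (hi : Function.Injective i)
    {g : B.R → A.R} (hg : IsBalanced g) (δ : ℤ)
    (h : ∀ c s, B.global (fun z => i (c z)) s =
      fun z => i (A.global c (fun z => g (s (z + δ))) z)) :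
    StochSub A B := by
  have hrestrict : B.CanRestrict i := by
    refine ⟨hi, fun c s hc z => ?_⟩
    choose c' hc' using hc
    obtain rfl : (fun z => i (c' z)) = c := funext hc'
    exact ⟨_, (congrFun (h c' s) z).symm⟩
  refine ⟨i, hrestrict, funext fun c => ?_⟩
  have hglobal : (B.restrict i).global c = A.global c ∘ fun s z => g (s (z + δ)) :=
    funext fun s => hi.comp_left ((B.global_restrict i hrestrict c s).trans (h c s))
  have hg' := measurable_of_finite g
  change A.randomSource.map (A.global c) = B.randomSource.map ((B.restrict i).global c)
  rw [hglobal, ← map_randomSource hg δ, Measure.map_map (A.measurable_global c) (by fun_prop)]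
  rfl

theorem StochSub.stochMix {A B : StochCA} (h : StochSub A B) : StochMix A B := by
  obtain ⟨i, hi, hglobal⟩ := h
  have hid : (B.restrict i).CanProject (id : A.Q → A.Q) :=
    ⟨Function.surjective_id, fun s c c' hc z => by rw [show c = c' from funext hc]⟩
  refine ⟨A.Q, inferInstance, inferInstance, i, id, hi, hid, hglobal.trans (funext fun c => ?_)⟩
  exact congrArg (B.randomSource.map ·)
    (funext fun s => ((B.restrict i).global_project id hid c s).symm)

theorem SimInj.simMix {A B : StochCA} (h : A.SimInj B) : A.SimMix B := by
  obtain ⟨m₁, m₂, t₁, t₂, k₁, k₂, h⟩ := h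
  exact ⟨m₁, m₂, t₁, t₂, k₁, k₂, h.stochMix⟩

/-! ### Optimality -/

/-- The automaton in which each cell becomes uniform on `Fin p`, independently of everything else.
It witnesses that the prime `p` is needed in the random alphabet. -/
def noise (p : ℕ) [NeZero p] : StochCA where
  Q := Fin p
  R := Fin p
  V := ∅
  V' := {0}
  f _ s := s ⟨0, by simp⟩

theorem global_noise (p : ℕ) [NeZero p] (c s : ℤ → Fin p) : (noise p).global c s = s :=
  funext fun z => congrArg s (add_zero z)

theorem PF_noise {p : ℕ} [NeZero p] (hp : p.Prime) : (noise p).PF = {p} := by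
  simp [PF, noise, hp.primeFactors]

theorem exists_stochGlobal_rescale_noise_eq (p m t : ℕ) [NeZero p] [NeZero m] (ht : t ≠ 0) (k : ℤ)
    (c : ℤ → ((noise p).rescale m t k).Q) :
    ∃ E : Set ((noise p).rescale m t k).Q,
      ((noise p).rescale m t k).stochGlobal c {d | d 0 ∈ E} = (p : ENNReal)⁻¹ := by
  obtain ⟨t, rfl⟩ := Nat.exists_eq_succ_of_ne_zero ht
  let l : Fin m := ⟨(k % (m : ℤ)).toNat, by
    have hm : (0 : ℤ) < m := by exact_mod_cast Nat.pos_of_neZero m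
    have := Int.emod_lt_of_pos k hm
    omega⟩
  let B := (noise p).rescale m (t + 1) k
  let g : B.R → Fin p := fun x => x (Fin.last t) l
  have hg : IsBalanced g := (IsBalanced.eval l).comp (IsBalanced.eval (Fin.last t))
  have hglobal (s : ℤ → B.R) : B.global c s 0 (0 : Fin m) = g (s (k / m)) := by
    refine (congrFun₂ ((noise p).global_rescale m (t + 1) k c s) 0 (0 : Fin m)).trans
      ((congrFun (global_noise p _ _) _).trans ?_)
    simp only [unpack, mul_zero, Fin.val_zero, Nat.cast_zero, zero_add]
    rfl
  refine ⟨{q | q (0 : Fin m) = (0 : Fin p)}, (B.stochGlobal_apply_eval c 0 _).trans ?_⟩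
  change B.randomSource {s | B.global c s 0 (0 : Fin m) = (0 : Fin p)} = _
  simp only [hglobal]
  exact (B.randomSource_apply_balanced_eq hg _ _).trans (by rw [Nat.card_fin])

theorem not_simMix_noise {p : ℕ} [NeZero p] (hp : p.Prime) {A : StochCA} (hA : p ∉ A.PF) :
    ¬(noise p).SimMix A := by
  rintro ⟨m₁, m₂, t₁, t₂, k₁, k₂, Q', _, _, i, π, -, -, h⟩
  have c : ℤ → ((noise p).rescale m₁ t₁ k₁).Q := Classical.arbitrary _
  obtain ⟨E, hE⟩ := exists_stochGlobal_rescale_noise_eq p m₁ t₁ t₁.ne_zero k₁ c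
  let B := ((A.rescale m₂ t₂ k₂).restrict i).project (Q' := ((noise p).rescale m₁ t₁ k₁).Q) π
  obtain ⟨k, n, hk⟩ := B.exists_stochGlobal_eq c 0 E
  have hdvd : p ∣ Nat.card B.R ^ n :=
    dvd_pow_of_mul_inv_pow_eq_inv Nat.card_pos.ne' hp.ne_zero (hk.symm.trans (h ▸ hE))
  have hcard : Nat.card B.R = (Nat.card A.R ^ (m₂ : ℕ)) ^ (t₂ : ℕ) := by
    change Nat.card (Fin t₂ → Fin m₂ → A.R) = _
    simp only [Nat.card_fun, Nat.card_fin]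
  rw [hcard] at hdvd
  exact hA (hp.mem_primeFactors
    (hp.dvd_of_dvd_pow (hp.dvd_of_dvd_pow (hp.dvd_of_dvd_pow hdvd))) Nat.card_pos.ne')

/-! ### The collision automaton -/

theorem pack_shift_mul {S : Type} (m : ℕ) (k : ℤ) (c : ℤ → S) :
    pack m (shift (m * k) c) = shift k (pack m c) := by
  funext z j
  simp only [pack, shift]
  ring_nf

theorem eq_unpack {S : Type} {m : ℕ} [NeZero m] {c : ℤ → Fin m → S} {d : ℤ → S}
    (h : ∀ (b : ℤ) (p : Fin m), d (m * b + (p : ℕ)) = c b p) : d = unpack m c := by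
  rw [← unpack_pack m d]
  exact congrArg _ (funext₂ h)

theorem iter_add (A : StochCA) (a b : ℕ) (c : ℤ → A.Q) (S : ℕ → ℤ → A.R) :
    A.iter (a + b) c (fun j => S j) =
      A.iter b (A.iter a c fun j => S j) fun j => S (a + j) := by
  induction b with
  | zero => rfl
  | succ b ih => exact congrArg (A.global · (S (a + b))) ih

variable {H D R : Type}

/-- What happens when a letter in `D` reaches a head in `H`: given the random symbol of the cell,
both are rewritten. -/
abbrev Collision (H D R : Type) := H → D → R → H × D

/-- The contents of the head track and of the letter track after the instruction `o`, which acts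
only if both are present. -/
def meet (o : Collision H D R) : Option H → Option D → R → Option H × Option D
  | some φ, some a, s => (some (o φ a s).1, some (o φ a s).2)
  | h, a, _ => (h, a)

@[simp]
theorem meet_none_left (o : Collision H D R) (a : Option D) (s : R) :
    meet o none a s = (none, a) := rfl

@[simp]
theorem meet_none_right (o : Collision H D R) (h : Option H) (s : R) :
    meet o h none s = (h, none) := by
  cases h <;> rfl

/-- The collision automaton. Instructions move left by two cells per step, letters by one, and heads
stay; in each cell the arriving instruction is applied to the head and the arriving letter. -/
abbrev collisionCA (H D R : Type) [Finite H] [Finite D] [Finite R] [Nonempty R] : StochCA where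
  Q := Collision H D R × Option H × Option D
  R := R
  nonemptyQ := ⟨(fun φ a _ => (φ, a), none, none)⟩
  V := {0, 1, 2}
  V' := {0}
  f x s := ((x ⟨2, by simp⟩).1,
    meet (x ⟨2, by simp⟩).1 (x ⟨0, by simp⟩).2.1 (x ⟨1, by simp⟩).2.2 (s ⟨0, by simp⟩))

section Finite

variable [Finite H] [Finite D] [Finite R] [Nonempty R]

theorem global_collisionCA (o : ℤ → Collision H D R) (h : ℤ → Option H) (a : ℤ → Option D)
    (s : ℤ → R) :
    (collisionCA H D R).global (fun x => (o x, h x, a x)) s =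
      fun x => (o (x + 2), meet (o (x + 2)) (h x) (a (x + 1)) (s x)) := by
  funext x
  simp only [global, collisionCA, add_zero]

theorem iter_collisionCA {o : ℤ → Collision H D R} {h : ℤ → ℤ → Option H}
    {a : ℤ → ℤ → Option D} {S : ℕ → ℤ → R} {T : ℕ}
    (hmeet : ∀ τ < T, ∀ x : ℤ, (h x (x + τ + 1), a x (x + τ + 1)) =
      meet (o (x + 2 * τ + 2)) (h x (x + τ)) (a (x + 1) (x + τ + 1)) (S τ x)) :
    (collisionCA H D R).iter T (fun x => (o x, h x x, a x x)) (fun j => S j) =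
      fun x => (o (x + 2 * T), h x (x + T), a x (x + T)) := by
  induction T with
  | zero =>
    simp only [iter, Nat.cast_zero, mul_zero, add_zero]
  | succ T ih =>
    have hstep := hmeet T T.lt_succ_self
    replace ih := ih fun τ hτ => hmeet τ (hτ.trans T.lt_succ_self)
    simp only [iter, Fin.val_castSucc, Fin.val_last, ih]
    refine (global_collisionCA _ _ _ _).trans (funext fun x => ?_)
    rw [add_right_comm x 2, add_right_comm x 1, ← hstep]
    push_cast
    ring_nf

end Finite

/-- The head with initial state `φ` after the first `n` letters of the word `X`, where `op n` is the
instruction for the letter `n`. -/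
def headAfter (op : ℕ → Collision H D R) (φ : H) (X : ℕ → D) (s : ℕ → R) : ℕ → H
  | 0 => φ
  | n + 1 => (op n (headAfter op φ X s n) (X n) (s n)).1

/-- The word `X` after the heads `0, …, i - 1`, where `op i n` is the instruction for the meeting of
the head `i` with the letter `n`. -/
def wordAfter (op : ℕ → ℕ → Collision H D R) (K : ℕ → H) (X : ℕ → D) (σ : ℕ → ℕ → R) :
    ℕ → ℕ → D
  | 0 => X
  | i + 1 => fun n =>
    (op i n (headAfter (op i) (K i) (wordAfter op K X σ i) (σ i) n) (wordAfter op K X σ i n)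
      (σ i n)).2

/-- The cell `p < 2 * L * I` of a block with a word `X` of length `L` and `I` heads in states `K`.
The heads stand `2 * L` apart, numbered from the right. The head `i` meets the letter `n` of the
next block at time `2 * L * i + n`, when the instruction from the cell `2 * L * i + 2 * n + 1` of
that block arrives. -/
def block (L I : ℕ) (op : ℕ → ℕ → Collision H D R) (K : ℕ → H) (X : ℕ → D) (p : ℕ) :
    Collision H D R × Option H × Option D :=
  (op (p / (2 * L)) (p % (2 * L) / 2),
    if 2 * L ∣ p + 1 then some (K (I - (p + 1) / (2 * L))) else none,
    if p < L then some (X p) else none)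

section Round

variable (L I : ℕ) (op : ℕ → ℕ → Collision H D R) (K : ℤ → ℕ → H) (X : ℤ → ℕ → D)
  (S : ℕ → ℤ → R)

/-- The random symbol present when the head `i` of the block `b` meets the letter `n`. -/
def symbolAt (b : ℤ) (i n : ℕ) : R :=
  S (n + 2 * L * i) (2 * L * I * (b + 1) - 1 - 2 * L * i)

/-- The word that the first `i` heads of the block `b` make of the word of the block `b + 1`. -/
def wordAt (b : ℤ) : ℕ → ℕ → D :=
  wordAfter op (K b) (X (b + 1)) (symbolAt L I S b)

/-- The head `i` of the block `b` after the first `n` letters of the word of the block `b + 1`. -/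
def headAt (b : ℤ) (i : ℕ) : ℕ → H :=
  headAfter (op i) (K b i) (wordAt L I op K X S b i) (symbolAt L I S b i)

/-- The head in the cell `x` at time `y - x`, when the letter from the cell `y` is there. -/
def spacetimeHead (x y : ℤ) : Option H :=
  if (2 * L : ℤ) ∣ x + 1 then
    let b := x / (2 * L * I)
    some (headAt L I op K X S b ((2 * L * I * (b + 1) - 1 - x) / (2 * L)).toNat
      (min (y + 1 - 2 * L * I * (b + 1)).toNat L))
  else none

/-- The letter from the cell `y` when it is in the cell `x`. -/
def spacetimeLetter (x y : ℤ) : Option D :=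
  if y % (2 * L * I) < L then
    let b := y / (2 * L * I)
    some (wordAt L I op K X S (b - 1) ((2 * L * I * b - 1 - x) / (2 * L) + 1).toNat
      (y % (2 * L * I)).toNat)
  else none

/-- The instruction that starts in the cell `z`. -/
def spacetimeInstruction (z : ℤ) : Collision H D R :=
  op ((z % (2 * L * I)) / (2 * L)).toNat ((z % (2 * L * I)) % (2 * L) / 2).toNat

variable {L I} {op} {K} {X} {S}

theorem spacetimeHead_eq {i n : ℕ} {b y : ℤ} (hL : 0 < L) (hi : i < I)
    (hn : min (y + 1 - 2 * L * I * (b + 1)).toNat L = n) :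
    spacetimeHead L I op K X S (2 * L * I * (b + 1) - 1 - 2 * L * i) y =
      some (headAt L I op K X S b i n) := by
  have hI : 0 < I := by omega
  have hb : (2 * L * I * (b + 1) - 1 - 2 * L * i) / (2 * L * I : ℤ) = b :=
    ((Int.ediv_emod_unique (r := 2 * L * I - 1 - 2 * L * i) (by positivity)).2
      ⟨by ring, by nlinarith, by nlinarith⟩).1
  have hdvd : (2 * L : ℤ) ∣ 2 * L * I * (b + 1) - 1 - 2 * L * i + 1 :=
    ⟨I * (b + 1) - i, by ring⟩
  rw [spacetimeHead, if_pos hdvd]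
  simp only [hb, sub_sub_cancel, hn]
  rw [Int.mul_ediv_cancel_left _ (by positivity), Int.toNat_natCast]

theorem spacetimeHead_of_not_dvd {x : ℤ} (hx : ¬(2 * L : ℤ) ∣ x + 1) (y : ℤ) :
    spacetimeHead L I op K X S x y = none := by
  rw [spacetimeHead, if_neg hx]

theorem exists_eq_of_dvd_add_one (hI : 0 < I) {x : ℤ} (hx : (2 * L : ℤ) ∣ x + 1) :
    ∃ b : ℤ, ∃ i < I, x = 2 * L * I * (b + 1) - 1 - 2 * L * i := by
  obtain ⟨k, hk⟩ := hx
  have hpos : 0 < (I : ℤ) := by exact_mod_cast hI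
  obtain ⟨i, hi⟩ := Int.eq_ofNat_of_zero_le (Int.emod_nonneg (-k) hpos.ne')
  refine ⟨-((-k) / I) - 1, i, by exact_mod_cast hi ▸ Int.emod_lt_of_pos (-k) hpos, ?_⟩
  have := Int.emod_add_mul_ediv (-k) I
  rw [hi] at this
  linear_combination hk + 2 * L * this

theorem spacetimeLetter_eq {i n : ℕ} {x b : ℤ} (hI : 0 < I) (hn : n < L)
    (hi : (2 * L * I * b - 1 - x) / (2 * L) + 1 = i) :
    spacetimeLetter L I op K X S x (2 * L * I * b + n) =
      some (wordAt L I op K X S (b - 1) i n) := by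
  have hL : 0 < L := by omega
  obtain ⟨hb, hmod⟩ := (Int.ediv_emod_unique (a := 2 * L * I * b + n) (q := b) (r := n)
    (b := 2 * L * I) (by positivity)).2 ⟨by ring, by positivity, by nlinarith⟩
  rw [spacetimeLetter, if_pos (by rw [hmod]; exact_mod_cast hn)]
  simp only [hb, hmod, hi, Int.toNat_natCast]

theorem spacetimeLetter_of_le {y : ℤ} (hy : L ≤ y % (2 * L * I)) (x : ℤ) :
    spacetimeLetter L I op K X S x y = none := by
  rw [spacetimeLetter, if_neg hy.not_gt]

theorem spacetimeLetter_add_one (hL : 0 < L) {x : ℤ} (hx : ¬(2 * L : ℤ) ∣ x + 1) (y : ℤ) :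
    spacetimeLetter L I op K X S (x + 1) y = spacetimeLetter L I op K X S x y := by
  set z : ℤ := 2 * L * I * (y / (2 * L * I)) - 1 - x with hz
  have hmod : z % (2 * L) ≠ 0 := fun h => hx <| by
    obtain ⟨k, hk⟩ := Int.dvd_of_emod_eq_zero h
    exact ⟨I * (y / (2 * L * I)) - k, by linear_combination -hk + hz⟩
  have hdiv : (z - 1) / (2 * L) = z / (2 * L) := by
    have hpos : (0 : ℤ) < 2 * L := by positivity
    have hlt := Int.emod_lt_of_pos z hpos
    have hge := Int.emod_nonneg z hpos.ne'
    exact ((Int.ediv_emod_unique (r := z % (2 * L) - 1) hpos).2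
      ⟨by linarith [Int.emod_add_mul_ediv z (2 * L)], by omega, by omega⟩).1
  simp only [spacetimeLetter, ← hz, ← hdiv]
  rw [hz, sub_sub _ x 1]

theorem spacetimeInstruction_eq {i n : ℕ} (hi : i < I) (hn : n < L) (b : ℤ) :
    spacetimeInstruction L I op (2 * L * I * b + 2 * L * i + 2 * n + 1) = op i n := by
  have hL : 0 < L := by omega
  have hI : 0 < I := by omega
  have hm : (2 * L * I * b + 2 * L * i + 2 * n + 1) % (2 * L * I : ℤ) =
      2 * L * i + 2 * n + 1 :=
    ((Int.ediv_emod_unique (q := b) (by positivity)).2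
      ⟨by ring, by positivity, by nlinarith⟩).2
  obtain ⟨hdiv, hmod⟩ := (Int.ediv_emod_unique (a := 2 * L * i + 2 * n + 1) (q := i)
    (r := 2 * n + 1) (b := 2 * L) (by positivity)).2 ⟨by ring, by positivity, by omega⟩
  rw [spacetimeInstruction, hm, hdiv, hmod, Int.toNat_natCast]
  congr 1
  omega

theorem spacetime_meet_letter {i n : ℕ} (hi : i < I) (hn : n < L) (b : ℤ) :
    let x : ℤ := 2 * L * I * (b + 1) - 1 - 2 * L * i
    let y : ℤ := 2 * L * I * (b + 1) + n
    (spacetimeHead L I op K X S x y, spacetimeLetter L I op K X S x y) =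
      meet (op i n) (spacetimeHead L I op K X S x (y - 1))
        (spacetimeLetter L I op K X S (x + 1) y) (S (n + 2 * L * i) x) := by
  intro x y
  have hL : 0 < L := by omega
  have hI : 0 < I := by omega
  have hpos : (0 : ℤ) < 2 * L := by positivity
  have hbefore : (2 * L * I * (b + 1) - 1 - (x + 1)) / (2 * L : ℤ) + 1 = i := by
    rw [((Int.ediv_emod_unique (q := i - 1) (r := 2 * L - 1) hpos).2
      ⟨by simp only [x]; ring, by omega, by omega⟩).1, sub_add_cancel]
  have hafter : (2 * L * I * (b + 1) - 1 - x) / (2 * L : ℤ) + 1 = (i + 1 : ℕ) := by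
    rw [sub_sub_cancel, Int.mul_ediv_cancel_left _ hpos.ne', Nat.cast_succ]
  rw [spacetimeHead_eq (y := y - 1) (n := n) hL hi (by omega),
    spacetimeHead_eq (y := y) (n := n + 1) hL hi (by omega),
    spacetimeLetter_eq hI hn hbefore, spacetimeLetter_eq hI hn hafter, add_sub_cancel_right]
  rfl

theorem spacetime_meet {τ : ℕ} (hτ : τ < 2 * L * I) (x : ℤ) :
    (spacetimeHead L I op K X S x (x + τ + 1), spacetimeLetter L I op K X S x (x + τ + 1)) =
      meet (spacetimeInstruction L I op (x + 2 * τ + 2)) (spacetimeHead L I op K X S x (x + τ))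
        (spacetimeLetter L I op K X S (x + 1) (x + τ + 1)) (S τ x) := by
  obtain ⟨⟨-, hL⟩, hI⟩ : (0 < 2 ∧ 0 < L) ∧ 0 < I := by
    simpa only [Nat.mul_pos_iff_of_pos_left, CanonicallyOrderedAdd.mul_pos] using hτ.pos
  by_cases hx : (2 * L : ℤ) ∣ x + 1
  swap
  · rw [spacetimeHead_of_not_dvd hx, spacetimeHead_of_not_dvd hx, meet_none_left,
      spacetimeLetter_add_one hL hx]
  obtain ⟨b, i, hi, rfl⟩ := exists_eq_of_dvd_add_one hI hx
  have hi₀ : (0 : ℤ) ≤ 2 * L * i := by positivity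
  have hi₁ : (2 * L * i + 2 * L : ℤ) ≤ 2 * L * I := by nlinarith
  have hτ' : (τ : ℤ) < 2 * L * I := by exact_mod_cast hτ
  have hblock : (2 * L * I * (b + 1) : ℤ) = 2 * L * I * b + 2 * L * I := by ring
  have hmod {b' r : ℤ} (h₀ : 0 ≤ r) (h : r < 2 * L * I) :
      (2 * L * I * b' + r) % (2 * L * I) = r := by
    rw [Int.mul_add_emod_self_left, Int.emod_eq_of_lt h₀ h]
  set x : ℤ := 2 * L * I * (b + 1) - 1 - 2 * L * i with hxi
  obtain hy | hy := lt_or_ge (x + τ + 1) (2 * L * I * (b + 1))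
  · obtain ⟨r, hr⟩ : ∃ r, x + τ + 1 = 2 * L * I * b + r := ⟨_, (add_sub_cancel _ _).symm⟩
    have hLr : L ≤ (x + τ + 1) % (2 * L * I) := by rw [hr, hmod] <;> omega
    rw [spacetimeLetter_of_le hLr, spacetimeLetter_of_le hLr, meet_none_right,
      spacetimeHead_eq (n := 0) hL hi (by omega), spacetimeHead_eq (n := 0) hL hi (by omega)]
  obtain ⟨n, hn⟩ := Int.le.dest hy
  obtain hnL | hnL := lt_or_ge n L
  · have hz : x + 2 * τ + 2 = 2 * L * I * (b + 1) + 2 * L * i + 2 * n + 1 := by linarith [hxi]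
    have hτn : τ = n + 2 * L * i := by zify; linarith [hxi]
    rw [hz, spacetimeInstruction_eq hi hnL, eq_sub_of_add_eq hn.symm, sub_add_cancel, hτn]
    exact spacetime_meet_letter hi hnL b
  · have hLn : L ≤ (x + τ + 1) % (2 * L * I) := by rw [← hn, hmod] <;> omega
    rw [spacetimeLetter_of_le hLn, spacetimeLetter_of_le hLn, meet_none_right,
      spacetimeHead_eq (n := L) hL hi (by omega), spacetimeHead_eq (n := L) hL hi (by omega)]

theorem spacetimeInstruction_natCast {p : ℕ} (hp : p < 2 * L * I) (b : ℤ) :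
    spacetimeInstruction L I op (2 * L * I * b + p) = op (p / (2 * L)) (p % (2 * L) / 2) := by
  rw [spacetimeInstruction, Int.mul_add_emod_self_left,
    Int.emod_eq_of_lt (by positivity) (by exact_mod_cast hp)]
  rfl

theorem spacetimeHead_natCast {p k : ℕ} {b y : ℤ} (hp : p < 2 * L * I)
    (hk : 2 * L ∣ p + 1 → min (y + 1 - 2 * L * I * (b + 1)).toNat L = k) :
    spacetimeHead L I op K X S (2 * L * I * b + p) y =
      if 2 * L ∣ p + 1 then some (headAt L I op K X S b (I - (p + 1) / (2 * L)) k) else none := by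
  have hdvd : (2 * L : ℤ) ∣ 2 * L * I * b + p + 1 ↔ 2 * L ∣ p + 1 := by
    rw [mul_assoc (2 * L : ℤ), add_assoc, dvd_add_right (dvd_mul_right _ _)]
    exact_mod_cast Iff.rfl
  split_ifs with h
  · obtain ⟨j, hj⟩ := h
    have hL : 0 < L := by by_contra! h; simp_all
    have hjI : j ≤ I := by
      rw [← Nat.add_one_le_iff, hj] at hp
      exact Nat.le_of_mul_le_mul_left hp (by positivity)
    have hj₀ : 0 < j := by by_contra! h; simp_all
    obtain ⟨i, rfl⟩ := Nat.exists_eq_add_of_le hjI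
    have hx : (2 * L * (j + i : ℕ) * b + p : ℤ) =
        2 * L * (j + i : ℕ) * (b + 1) - 1 - 2 * L * i := by
      push_cast
      linear_combination (by exact_mod_cast hj : (p + 1 : ℤ) = 2 * L * j)
    rw [hx, spacetimeHead_eq hL (by omega) (hk ⟨j, hj⟩), hj, Nat.mul_div_cancel_left _ (by omega),
      Nat.add_sub_cancel_left]
  · exact spacetimeHead_of_not_dvd (hdvd.not.2 h) y

theorem spacetimeLetter_natCast {p i : ℕ} {x b : ℤ} (hp : p < 2 * L * I)
    (hi : p < L → (2 * L * I * b - 1 - x) / (2 * L) + 1 = i) :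
    spacetimeLetter L I op K X S x (2 * L * I * b + p) =
      if p < L then some (wordAt L I op K X S (b - 1) i p) else none := by
  have hI : 0 < I := by by_contra! h; simp_all
  split_ifs with h
  · exact spacetimeLetter_eq hI h (hi h)
  · refine spacetimeLetter_of_le ?_ x
    rw [Int.mul_add_emod_self_left, Int.emod_eq_of_lt (by positivity) (by exact_mod_cast hp)]
    exact_mod_cast not_lt.1 h

theorem spacetime_zero {p : ℕ} (hp : p < 2 * L * I) (b : ℤ) :
    let x : ℤ := 2 * L * I * b + p
    (spacetimeInstruction L I op x, spacetimeHead L I op K X S x x,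
      spacetimeLetter L I op K X S x x) = block L I op (K b) (X b) p := by
  intro x
  have hblock : (2 * L * I * (b + 1) : ℤ) = 2 * L * I * b + 2 * L * I := by ring
  rw [spacetimeInstruction_natCast hp,
    spacetimeHead_natCast (k := 0) hp fun _ => by zify at hp; omega,
    spacetimeLetter_natCast (i := 0) hp fun h => ?_]
  · simp only [block, headAt, headAfter, wordAt, wordAfter, sub_add_cancel]
  · rw [((Int.ediv_emod_unique (q := -1) (r := 2 * L - 1 - p) (by omega)).2
      ⟨by simp only [x]; ring, by omega, by omega⟩).1]
    rfl

theorem spacetime_period {p : ℕ} (hp : p < 2 * L * I) (b : ℤ) :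
    let x : ℤ := 2 * L * I * b + p
    (spacetimeInstruction L I op (x + 2 * (2 * L * I)),
      spacetimeHead L I op K X S x (x + 2 * L * I),
      spacetimeLetter L I op K X S x (x + 2 * L * I)) =
        block L I op (fun i => headAt L I op K X S b i L) (wordAt L I op K X S b I) p := by
  intro x
  have hy : x + 2 * L * I = 2 * L * I * (b + 1) + p := by ring
  have hz : x + 2 * (2 * L * I) = 2 * L * I * (b + 2) + p := by ring
  rw [hy, hz, spacetimeInstruction_natCast hp, spacetimeHead_natCast (k := L) hp fun h => ?_,
    spacetimeLetter_natCast (i := I) hp fun h => ?_]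
  · simp only [block, add_sub_cancel_right]
  · rw [((Int.ediv_emod_unique (q := I - 1) (r := 2 * L - 1 - p) (by omega)).2
      ⟨by simp only [x]; ring, by omega, by omega⟩).1, sub_add_cancel]
  · have := Nat.le_of_dvd (by omega) h
    omega

theorem iter_unpack_block [Finite H] [Finite D] [Finite R] [Nonempty R] [NeZero (2 * L * I)] :
    (collisionCA H D R).iter (2 * L * I)
        (unpack (2 * L * I) fun b p => block L I op (K b) (X b) p) (fun j => S j) =
      unpack (2 * L * I) fun b p =>
        block L I op (fun i => headAt L I op K X S b i L) (wordAt L I op K X S b I) p := by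
  have hstart : (fun x => (spacetimeInstruction L I op x, spacetimeHead L I op K X S x x,
      spacetimeLetter L I op K X S x x)) =
        unpack (2 * L * I) fun b p => block L I op (K b) (X b) p :=
    eq_unpack fun b p => by
      push_cast
      exact spacetime_zero p.2 b
  refine (congrArg (fun c => (collisionCA H D R).iter (2 * L * I) c fun j => S j)
    hstart.symm).trans ((iter_collisionCA fun τ hτ => spacetime_meet hτ).trans
      (eq_unpack (m := 2 * L * I) fun b p => ?_))
  push_cast
  exact spacetime_period p.2 b

end Round

theorem block_congr {L I : ℕ} {op : ℕ → ℕ → Collision H D R} {K K' : ℕ → H} {X X' : ℕ → D}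
    (hK : ∀ i < I, K i = K' i) (hX : ∀ n < L, X n = X' n) {p : ℕ} (hp : p < 2 * L * I) :
    block L I op K X p = block L I op K' X' p := by
  simp only [block, Prod.mk.injEq, true_and]
  refine ⟨if_ctx_congr Iff.rfl (fun h => ?_) fun _ => rfl,
    if_ctx_congr Iff.rfl (fun h => congrArg some (hX p h)) fun _ => rfl⟩
  have hI : 0 < I := by by_contra! h; simp_all
  have hL : 0 < 2 * L := by by_contra! h; simp_all
  rw [hK _ (Nat.sub_lt hI (Nat.div_pos (Nat.le_of_dvd (Nat.succ_pos _) h) hL))]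

/-! ### The program of a local rule -/

section Rule

variable {Γ R : Type} {L M : ℕ} [NeZero L]

/-- The word `y` with the clock `κ` attached to each letter. -/
def letters (κ : Fin 3) (y : Fin L → Γ) (n : ℕ) : Fin 3 × Γ :=
  (κ, y (Fin.ofNat L n))

/-- The instruction for the first head of a block: it advances the clock, and refreshes the letter
with the random symbol once in three rounds. -/
def clockOp (fresh : Γ → R → Γ) : Collision Bool (Fin 3 × Γ) R :=
  fun φ a s => (φ, a.1 + 1, if a.1 = 2 then fresh a.2 s else a.2)

open Classical in
/-- The instruction for the letter `n` and a head whose flag tells whether the words seen so far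
agree with `w 0` and `w 1`. At clock `2` a flagged head writes `w 2`, and the flag is reset on the
last letter. -/
noncomputable def entryOp (w : Fin 3 → Fin L → Γ) (n : ℕ) : Collision Bool (Fin 3 × Γ) R :=
  fun φ a _ =>
    if a.1 = 2 then (φ || n + 1 = L, 2, if φ then w 2 (Fin.ofNat L n) else a.2)
    else (φ && a.2 = w a.1 (Fin.ofNat L n), a)

theorem headAfter_entryOp_of_ne {κ : Fin 3} (hκ : κ ≠ 2) (w : Fin 3 → Fin L → Γ) (φ : Bool)
    {y : Fin L → Γ} {X : ℕ → Fin 3 × Γ} (hX : ∀ n < L, X n = letters κ y n) (s : ℕ → R) :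
    headAfter (entryOp w) φ X s L = true ↔ φ = true ∧ y = w κ := by
  have hprefix (n : ℕ) (hn : n ≤ L) : headAfter (entryOp w) φ X s n = true ↔
      φ = true ∧ ∀ k < n, y (Fin.ofNat L k) = w κ (Fin.ofNat L k) := by
    induction n with
    | zero => simp [headAfter]
    | succ n ih =>
      rw [Nat.forall_lt_succ_right, ← and_assoc, ← ih (by omega)]
      simp [headAfter, entryOp, hX n hn, letters, hκ]
  rw [hprefix L le_rfl, funext_iff, Fin.forall_iff]
  refine and_congr_right' (forall₂_congr fun n hn => ?_)
  rw [show Fin.ofNat L n = ⟨n, hn⟩ from Fin.ext (Nat.mod_eq_of_lt hn)]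

theorem headAfter_entryOp_two (w : Fin 3 → Fin L → Γ) (φ : Bool) {X : ℕ → Fin 3 × Γ}
    (hX : ∀ n < L, (X n).1 = 2) (s : ℕ → R) {n : ℕ} (hn : n ≤ L) :
    headAfter (entryOp w) φ X s n = (φ || n = L) := by
  induction n with
  | zero => simp [headAfter, (NeZero.ne L).symm]
  | succ n ih =>
    simp [headAfter, entryOp, hX n hn, ih (by omega), (Nat.lt_of_succ_le hn).ne]

/-- The program of the rule `F`: after the clock head, one head for each entry of the `table` of
pairs of words to which `F` can be applied. -/
noncomputable def ruleOp (fresh : Γ → R → Γ) (F : (Fin L → Γ) → (Fin L → Γ) → Fin L → Γ)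
    (table : ℕ → (Fin L → Γ) × (Fin L → Γ)) : ℕ → ℕ → Collision Bool (Fin 3 × Γ) R
  | 0, _ => clockOp fresh
  | i + 1, n => entryOp ![(table i).1, (table i).2, F (table i).1 (table i).2] n

/-- The states of the heads of a block whose entry heads carry the flags `φ`; that of the clock head
is irrelevant. -/
def heads (φ : ℕ → Bool) : ℕ → Bool
  | 0 => true
  | i + 1 => φ i

variable (fresh : Γ → R → Γ) (F : (Fin L → Γ) → (Fin L → Γ) → Fin L → Γ)
  (table : ℕ → (Fin L → Γ) × (Fin L → Γ))

theorem wordAfter_ruleOp_of_ne {κ : Fin 3} (hκ : κ ≠ 2) {K : ℕ → Bool} {X : ℕ → Fin 3 × Γ}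
    {σ : ℕ → ℕ → R} {y : Fin L → Γ}
    (h : ∀ n < L, wordAfter (ruleOp fresh F table) K X σ 1 n = letters κ y n) (i : ℕ) {n : ℕ}
    (hn : n < L) : wordAfter (ruleOp fresh F table) K X σ (i + 1) n = letters κ y n := by
  induction i with
  | zero => exact h n hn
  | succ i ih => simp [wordAfter.eq_2 _ _ _ _ (i + 1), ih, ruleOp, entryOp, letters, hκ]

theorem fst_wordAfter_ruleOp_two {K : ℕ → Bool} {X : ℕ → Fin 3 × Γ} {σ : ℕ → ℕ → R}
    (h : ∀ n < L, (wordAfter (ruleOp fresh F table) K X σ 1 n).1 = 2) (i : ℕ) {n : ℕ}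
    (hn : n < L) : (wordAfter (ruleOp fresh F table) K X σ (i + 1) n).1 = 2 := by
  induction i with
  | zero => exact h n hn
  | succ i ih => simp [wordAfter.eq_2 _ _ _ _ (i + 1), ih, ruleOp, entryOp]

theorem wordAfter_ruleOp_two {K : ℕ → Bool} {X : ℕ → Fin 3 × Γ} {σ : ℕ → ℕ → R}
    (h : ∀ n < L, (wordAfter (ruleOp fresh F table) K X σ 1 n).1 = 2) {u v : Fin L → Γ}
    (hK : ∀ i < M, K (i + 1) = true ↔ table i = (u, v)) (htable : ∃ i < M, table i = (u, v))
    {n : ℕ} (hn : n < L) :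
    wordAfter (ruleOp fresh F table) K X σ (M + 1) n = letters 2 (F u v) n := by
  have hfst := fst_wordAfter_ruleOp_two fresh F table h
  have hstep (i : ℕ) : (wordAfter (ruleOp fresh F table) K X σ (i + 2) n).2 =
      if K (i + 1) then F (table i).1 (table i).2 (Fin.ofNat L n)
      else (wordAfter (ruleOp fresh F table) K X σ (i + 1) n).2 := by
    have hhead : headAfter (ruleOp fresh F table (i + 1)) (K (i + 1))
        (wordAfter (ruleOp fresh F table) K X σ (i + 1)) (σ (i + 1)) n = (K (i + 1) || n = L) :=
      headAfter_entryOp_two _ _ (fun n => hfst i (n := n)) _ hn.le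
    simp [wordAfter.eq_2 _ _ _ _ (i + 1), ruleOp, entryOp, hfst i hn, hhead, hn.ne]
  obtain ⟨i, hi, hi_eq⟩ := htable
  refine Prod.ext (hfst M hn) ?_
  change _ = F u v (Fin.ofNat L n)
  induction M, hi using Nat.le_induction with
  | base => rw [hstep i, if_pos ((hK i i.lt_succ_self).2 hi_eq), hi_eq]
  | succ M _ ih =>
    rw [hstep M]
    split_ifs with hM
    · rw [(hK M M.lt_succ_self).1 hM]
    · exact ih fun j hj => hK j (by omega)

theorem wordAfter_ruleOp_one (K : ℕ → Bool) (κ : Fin 3) (y : Fin L → Γ) (σ : ℕ → ℕ → R) {n : ℕ}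
    (hn : n < L) :
    wordAfter (ruleOp fresh F table) K (letters κ y) σ 1 n =
      letters (κ + 1) (fun j => if κ = 2 then fresh (y j) (σ 0 j) else y j) n := by
  by_cases h : κ = 2 <;> simp [wordAfter, ruleOp, clockOp, letters, h, Nat.mod_eq_of_lt hn]

theorem headAfter_ruleOp_zero (φ : Bool) (X : ℕ → Fin 3 × Γ) (s : ℕ → R) (n : ℕ) :
    headAfter (ruleOp fresh F table 0) φ X s n = φ := by
  induction n with
  | zero => rfl
  | succ _ ih => exact ih

variable [Finite Γ] [Finite R] [Nonempty R]

/-- The block that holds the program of `ruleOp` and the word `y` with clock `κ`, and whose entry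
heads carry the flags `φ`. -/
noncomputable def ruleBlock (M : ℕ) (κ : Fin 3) (φ : ℕ → Bool) (y : Fin L → Γ) :
    Fin (2 * L * (M + 1)) → (collisionCA Bool (Fin 3 × Γ) R).Q :=
  fun p => block L (M + 1) (ruleOp fresh F table) (heads φ) (letters κ y) p

theorem ruleBlock_injective (M : ℕ) (κ : Fin 3) (φ : ℕ → Bool) :
    Function.Injective (ruleBlock fresh F table M κ φ) := by
  intro y y' h
  funext j
  have hj : (j : ℕ) < 2 * L * (M + 1) := by nlinarith [j.2]
  have := congrArg (fun q => q.2.2) (congrFun h ⟨j, hj⟩)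
  simpa [ruleBlock, block, letters] using this

/-- The configuration made of the blocks `ruleBlock` with flags `φ b` and words `Y b`. -/
noncomputable def ruleConfig (M : ℕ) (κ : Fin 3) (φ : ℤ → ℕ → Bool) (Y : ℤ → Fin L → Γ) :
    ℤ → (collisionCA Bool (Fin 3 × Γ) R).Q :=
  unpack (2 * L * (M + 1)) fun b => ruleBlock fresh F table M κ (φ b) (Y b)

variable {fresh} {F} {table} {κ κ' : Fin 3} {φ φ' : ℤ → ℕ → Bool} {Y Y' : ℤ → Fin L → Γ}

theorem iter_ruleConfig (S : ℕ → ℤ → R)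
    (hφ : ∀ b, ∀ i < M, headAt L (M + 1) (ruleOp fresh F table) (fun b => heads (φ b))
      (fun b => letters κ (Y b)) S b (i + 1) L = φ' b i)
    (hY : ∀ b, ∀ n < L, wordAt L (M + 1) (ruleOp fresh F table) (fun b => heads (φ b))
      (fun b => letters κ (Y b)) S b (M + 1) n = letters κ' (Y' b) n) :
    (collisionCA Bool (Fin 3 × Γ) R).iter (2 * L * (M + 1))
      (ruleConfig fresh F table M κ φ Y) (fun j => S j) = ruleConfig fresh F table M κ' φ' Y' := by
  refine iter_unpack_block.trans (congrArg _ (funext₂ fun b p => block_congr ?_ (hY b) p.2))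
  rintro (_ | i) hi
  · exact headAfter_ruleOp_zero fresh F table _ _ _ _
  · exact hφ b i (by omega)

theorem iter_ruleConfig_of_ne (S : ℕ → ℤ → R) (hκ : κ + 1 ≠ 2)
    (hY : ∀ b j, Y' b j = if κ = 2
      then fresh (Y (b + 1) j) (S j (2 * L * (M + 1) * (b + 1) - 1)) else Y (b + 1) j)
    (hφ : ∀ b, ∀ i < M, φ' b i = true ↔ φ b i = true ∧
      Y' b = ![(table i).1, (table i).2, F (table i).1 (table i).2] (κ + 1)) :
    (collisionCA Bool (Fin 3 × Γ) R).iter (2 * L * (M + 1))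
      (ruleConfig fresh F table M κ φ Y) (fun j => S j) =
        ruleConfig fresh F table M (κ + 1) φ' Y' := by
  have hword (b : ℤ) (i n : ℕ) (hn : n < L) :
      wordAt L (M + 1) (ruleOp fresh F table) (fun b => heads (φ b))
        (fun b => letters κ (Y b)) S b (i + 1) n = letters (κ + 1) (Y' b) n := by
    refine wordAfter_ruleOp_of_ne fresh F table hκ (fun n hn => ?_) i hn
    rw [wordAfter_ruleOp_one fresh F table _ _ _ _ hn]
    simp [symbolAt, funext (hY b)]
  refine iter_ruleConfig S (fun b i hi => ?_) fun b n hn => hword b M n hn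
  rw [Bool.eq_iff_iff, hφ b i hi]
  exact headAfter_entryOp_of_ne hκ _ _ (hword b i) _

theorem iter_ruleConfig_one (S : ℕ → ℤ → R) {u v : ℤ → Fin L → Γ}
    (hφ : ∀ b, ∀ i < M, φ b i = true ↔ table i = (u b, v b))
    (htable : ∀ b, ∃ i < M, table i = (u b, v b)) :
    (collisionCA Bool (Fin 3 × Γ) R).iter (2 * L * (M + 1))
      (ruleConfig fresh F table M 1 φ Y) (fun j => S j) =
        ruleConfig fresh F table M 2 (fun _ _ => true) fun b => F (u b) (v b) := by
  have hfst (b : ℤ) (n : ℕ) (hn : n < L) :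
      (wordAt L (M + 1) (ruleOp fresh F table) (fun b => heads (φ b))
        (fun b => letters 1 (Y b)) S b 1 n).1 = 2 := by
    rw [wordAt, wordAfter_ruleOp_one fresh F table _ _ _ _ hn]
    rfl
  refine iter_ruleConfig S (fun b i _ => ?_) fun b n hn =>
    wordAfter_ruleOp_two fresh F table (hfst b) (hφ b) (htable b) hn
  exact (headAfter_entryOp_two _ _ (fun n => fst_wordAfter_ruleOp_two fresh F table (hfst b) i)
    _ le_rfl).trans (by simp)

theorem iter_ruleConfig_three_rounds (S : ℕ → ℤ → R) (htable : ∀ w, ∃ i < M, table i = w) :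
    let m := 2 * L * (M + 1)
    let W (b : ℤ) (j : Fin L) := fresh (Y (b + 1) j) (S j (m * (b + 1) - 1))
    (collisionCA Bool (Fin 3 × Γ) R).iter (m + m + m)
      (ruleConfig fresh F table M 2 (fun _ _ => true) Y) (fun j => S j) =
        ruleConfig fresh F table M 2 (fun _ _ => true) fun b => F (W b) (W (b + 1)) := by
  classical
  intro m W
  have hround₀ : (collisionCA Bool (Fin 3 × Γ) R).iter m
      (ruleConfig fresh F table M 2 (fun _ _ => true) Y) (fun j => S j) =
        ruleConfig fresh F table M 0 (fun b i => W b = (table i).1) W :=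
    iter_ruleConfig_of_ne (κ := 2) S (by decide) (by simp [W, m]) (by simp)
  have hround₁ : (collisionCA Bool (Fin 3 × Γ) R).iter m
      (ruleConfig fresh F table M 0 (fun b i => W b = (table i).1) W) (fun j => S (m + j)) =
        ruleConfig fresh F table M 1
          (fun b i => W b = (table i).1 ∧ W (b + 1) = (table i).2) fun b => W (b + 1) :=
    iter_ruleConfig_of_ne (κ := 0) (fun j => S (m + j)) (by decide) (by simp) (by simp)
  rw [iter_add, iter_add, hround₀, hround₁]
  refine iter_ruleConfig_one (fun j => S (m + m + j)) (fun b i _ => ?_)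
    fun b => htable (W b, W (b + 1))
  rw [decide_eq_true_iff, Prod.ext_iff, eq_comm, @eq_comm _ (W (b + 1))]

theorem rescaleGlobal_ruleBlock (htable : ∀ w, ∃ i < M, table i = w) :
    let m := 2 * L * (M + 1)
    ∀ last : Fin m, (last : ℕ) + 1 = m → ∀ (hL : L ≤ m + m + m) (Y : ℤ → Fin L → Γ)
      (s : ℤ → Fin (m + m + m) → Fin m → R),
      let W (b : ℤ) (j : Fin L) := fresh (Y (b + 1) j) (s b (j.castLE hL) last)
      (collisionCA Bool (Fin 3 × Γ) R).rescaleGlobal m (m + m + m) (-m)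
        (fun z => ruleBlock fresh F table M 2 (fun _ => true) (Y z)) s =
          fun z => ruleBlock fresh F table M 2 (fun _ => true) (F (W (z - 1)) (W z)) := by
  intro m last hlast hL Y s W
  have : NeZero (m + m + m) := ⟨by have := last.pos; omega⟩
  let S (τ : ℕ) : ℤ → R := unpack m fun z => s z (Fin.ofNat _ τ)
  have hS : (fun j : Fin (m + m + m) => unpack m fun z => s z j) = fun j : Fin _ => S j := by
    simp only [S, Fin.ofNat_val_eq_self]
  have hW : W = fun b j => fresh (Y (b + 1) j) (S j (m * (b + 1) - 1)) := by
    funext b j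
    have hlast' : (m * (b + 1) - 1 : ℤ) = m * b + (last : ℕ) := by
      linear_combination -(by exact_mod_cast hlast : (last + 1 : ℤ) = m)
    have hj : Fin.ofNat (m + m + m) j = j.castLE hL := Fin.ext (Nat.mod_eq_of_lt (by omega))
    have hsymbol : S j (m * b + (last : ℕ)) = s b (j.castLE hL) last :=
      (congrFun₂ (pack_unpack m fun z => s z (Fin.ofNat _ j)) b last).trans (by rw [hj])
    rw [hlast', hsymbol]
  have hrun := iter_ruleConfig_three_rounds (fresh := fresh) (F := F) (Y := Y) S htable
  rw [rescaleGlobal, hS]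
  refine (congrArg (pack m ∘ shift (-m)) hrun).trans ?_
  rw [Function.comp_apply, ← mul_neg_one, pack_shift_mul, ruleConfig, pack_unpack]
  funext z
  simp only [shift, ← sub_eq_add_neg, sub_add_cancel, hW]
  rfl

end Rule

/-! ### Universality -/

/-- The universal automaton with random alphabet `R`. A letter of its data words holds one bit of an
encoded state and the latest random symbol that the letter has picked up. -/
abbrev univCA (R : Type) [Finite R] [Nonempty R] : StochCA :=
  collisionCA Bool (Fin 3 × Bool × R) R

theorem exists_stochSub_rescale_univCA {A : StochCA} {R : Type} [Finite R] [Nonempty R] {L : ℕ}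
    [NeZero L] (f : A.Q → A.Q → A.R → A.R → A.Q)
    (hf : ∀ c s z, A.global c s z = f (c z) (c (z + 1)) (s z) (s (z + 1)))
    {enc : A.Q → Fin L → Bool} (henc : Function.Injective enc)
    {g : (Fin L → R) → A.R} (hg : IsBalanced g) :
    ∃ (m t : ℕ+) (k : ℤ), StochSub A ((univCA R).rescale m t k) := by
  have r₀ : R := Classical.arbitrary R
  obtain ⟨M, table, htable⟩ := exists_enumeration ((Fin L → Bool × R) × (Fin L → Bool × R))
  let m := 2 * L * (M + 1)
  have hm : 0 < m := Nat.pos_of_neZero m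
  have hL : L ≤ m + m + m := by simp only [m]; nlinarith
  let last : Fin m := ⟨m - 1, by omega⟩
  let word (q : A.Q) (j : Fin L) : Bool × R := (enc q j, r₀)
  let state (u : Fin L → Bool × R) : A.Q := Function.invFun enc fun j => (u j).1
  let symbol (u : Fin L → Bool × R) : A.R := g fun j => (u j).2
  let fresh (a : Bool × R) (r : R) : Bool × R := (a.1, r)
  let F (u v : Fin L → Bool × R) := word (f (state u) (state v) (symbol u) (symbol v))
  let G (x : Fin (m + m + m) → Fin m → R) : A.R := g fun j => x (j.castLE hL) last
  have hword : Function.Injective word := fun q q' h =>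
    henc (funext fun j => congrArg Prod.fst (congrFun h j))
  have hG : IsBalanced G := by
    have hread : Function.Injective fun j : Fin L => (j.castLE hL, last) :=
      fun j j' h => Fin.castLE_injective hL (congrArg Prod.fst h)
    exact (hg.comp (.precomp hread)).comp (.of_equiv (Equiv.curry _ _ _).symm)
  refine ⟨⟨m, hm⟩, ⟨m + m + m, by omega⟩, -m, ?_⟩
  refine stochSub_of_global_eq (B := (univCA R).rescale m (m + m + m) (-m)) _
    ((ruleBlock_injective fresh F table M 2 fun _ => true).comp hword) hG (-1) fun c s => ?_
  refine ((univCA R).global_rescale m (m + m + m) (-m) _ s).trans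
    ((rescaleGlobal_ruleBlock htable last (by simp only [last]; omega) hL _ s).trans
      (funext fun z => congrArg _ ?_))
  simp [F, fresh, state, symbol, word, G, hf, sub_eq_add_neg, Function.leftInverse_invFun henc _]

theorem exists_global_eq {B : StochCA} (hV : B.V ⊆ {0, 1}) (hV' : B.V' ⊆ {0, 1}) :
    ∃ f : B.Q → B.Q → B.R → B.R → B.Q,
      ∀ c s z, B.global c s z = f (c z) (c (z + 1)) (s z) (s (z + 1)) := by
  have hpair {X : Type} {N : Finset ℤ} (hN : N ⊆ {0, 1}) (x : ℤ → X) (z : ℤ) :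
      (fun v : N => x (z + v)) = fun v : N => if (v : ℤ) = 0 then x z else x (z + 1) := by
    funext ⟨v, hv⟩
    rcases Finset.mem_insert.1 (hN hv) with rfl | h
    · simp
    · simp [Finset.mem_singleton.1 h]
  refine ⟨fun q q' r r' => B.f (fun v => if (v : ℤ) = 0 then q else q')
    (fun v => if (v : ℤ) = 0 then r else r'), fun c s z => ?_⟩
  rw [global, hpair hV, hpair hV']

theorem blockNbhd_subset {N : Finset ℤ} {r : ℕ} (h : ∀ v ∈ N, v.natAbs ≤ r) :
    blockNbhd (2 * r + 1) r N ⊆ {0, 1} := by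
  intro x hx
  obtain ⟨⟨j, v⟩, hp, rfl⟩ := Finset.mem_image.1 hx
  obtain ⟨hj, hv⟩ := Finset.mem_product.1 hp
  have hj' := Finset.mem_range.1 hj
  have hv' := h v hv
  have hpos : (0 : ℤ) < (2 * r + 1 : ℕ) := by positivity
  have hnonneg : 0 ≤ ((j : ℤ) + r + v) / (2 * r + 1 : ℕ) := Int.ediv_nonneg (by omega) hpos.le
  have hlt : ((j : ℤ) + r + v) / (2 * r + 1 : ℕ) < 2 := by
    rw [Int.ediv_lt_iff_lt_mul hpos]
    omega
  simp only [Finset.mem_insert, Finset.mem_singleton]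
  omega

theorem exists_rescale_nbhd_subset (A : StochCA) :
    ∃ r : ℕ, (A.rescale (2 * r + 1) 1 r).V ⊆ {0, 1} ∧ (A.rescale (2 * r + 1) 1 r).V' ⊆ {0, 1} := by
  refine ⟨(A.V ∪ A.V').sup Int.natAbs, blockNbhd_subset fun v hv => Finset.le_sup ?_,
    blockNbhd_subset fun v hv => Finset.le_sup ?_⟩
  · exact Finset.mem_union_left _ (by simpa [iterV, Finset.mem_add] using hv)
  · exact Finset.mem_union_right _ (by simpa [iterV'] using hv)

theorem exists_card_dvd_pow {A : StochCA} {n : ℕ} (hA : A.PF ⊆ n.primeFactors) :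
    ∃ k, Nat.card A.R ∣ n ^ k := by
  refine (UniqueFactorizationMonoid.exists_dvd_pow_iff_radical_dvd Nat.card_pos.ne').2 ?_
  rw [Nat.radical_eq_prod_primeFactors]
  exact (Finset.prod_dvd_prod_of_subset _ _ _ hA).trans n.prod_primeFactors_dvd

theorem simInj_univCA {R : Type} [Finite R] [Nonempty R] {A : StochCA}
    (hA : A.PF ⊆ (Nat.card R).primeFactors) : A.SimInj (univCA R) := by
  obtain ⟨r, hV, hV'⟩ := A.exists_rescale_nbhd_subset
  obtain ⟨f, hf⟩ := exists_global_eq hV hV'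
  obtain ⟨k, hk⟩ := exists_card_dvd_pow hA
  let B := A.rescale (2 * r + 1) 1 r
  let L := Nat.card B.Q + k * (2 * r + 1)
  have : NeZero L := ⟨by have : 0 < Nat.card B.Q := Nat.card_pos; omega⟩
  obtain ⟨enc⟩ : Nonempty (B.Q ↪ (Fin L → Bool)) := by
    cases nonempty_fintype B.Q
    refine Function.Embedding.nonempty_of_card_le ?_
    rw [← Nat.card_eq_fintype_card, Fintype.card_fun, Fintype.card_bool, Fintype.card_fin]
    exact (Nat.le_add_right _ _).trans Nat.lt_two_pow_self.le
  obtain ⟨g, hg⟩ : ∃ g : (Fin L → R) → B.R, IsBalanced g := by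
    refine IsBalanced.exists_of_dvd ?_
    calc Nat.card B.R = Nat.card A.R ^ (2 * r + 1) := by
          change Nat.card (Fin 1 → Fin (2 * r + 1) → A.R) = _
          simp [Nat.card_fun]
      _ ∣ (Nat.card R ^ k) ^ (2 * r + 1) := pow_dvd_pow_of_dvd hk _
      _ ∣ Nat.card R ^ L := by
          rw [← pow_mul]
          exact pow_dvd_pow _ (Nat.le_add_left _ _)
      _ = Nat.card (Fin L → R) := by simp [Nat.card_fun]
  obtain ⟨m, t, k', h⟩ := exists_stochSub_rescale_univCA f hf enc.injective hg
  exact ⟨⟨2 * r + 1, by omega⟩, m, 1, t, r, k', h⟩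

end StochCA

theorem theorem6 (P : Finset ℕ) (hP : ∀ p ∈ P, p.Prime) :
    (∃ U : StochCA, U.IsPCA ∧ U.PF = P ∧
      ∀ A : StochCA, A.PF ⊆ P → A.SimInj U ∧ A.SimMix U) ∧
    (∀ p : ℕ, p.Prime → p ∉ P →
      ∃ A : StochCA, A.PF = {p} ∧
        ∀ U : StochCA, U.PF ⊆ P → ¬ A.SimInj U ∧ ¬ A.SimMix U) := by
  refine ⟨?_, fun p hp hpP => ?_⟩
  · have : NeZero (∏ p ∈ P, p) := ⟨Finset.prod_ne_zero_iff.2 fun p hp => (hP p hp).ne_zero⟩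
    have hPF : (Nat.card (Fin (∏ p ∈ P, p))).primeFactors = P := by
      rw [Nat.card_fin, Nat.primeFactors_prod hP]
    refine ⟨StochCA.univCA (Fin (∏ p ∈ P, p)), rfl, hPF, fun A hA => ?_⟩
    have h := StochCA.simInj_univCA (hA.trans hPF.ge)
    exact ⟨h, h.simMix⟩
  · have : NeZero p := ⟨hp.ne_zero⟩
    refine ⟨StochCA.noise p, StochCA.PF_noise hp, fun U hU => ?_⟩
    have h := StochCA.not_simMix_noise hp fun hpU => hpP (hU hpU)
    exact ⟨fun h' => h h'.simMix, h⟩
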